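/- Let $p$ be a prime, let $k$ be an algebraically closed field of characteristic $p$, let $W(k)$ be the ring of ($p$-typical) Witt vectors of $k$, and let $\sigma$ be its Frobenius automorphism. A Dieudonné module over $k$ is a pair $(M,\phi)$ where $M$ is a free $W(k)$-module of finite rank and $\phi:M\to M$ is a $\sigma$-linear map with $pM\subseteq\phi(M)$. It is called supersingular if all the slopes of its Newton polygon are $1/2$; here the slopes are those given by the Dieudonné–Manin decomposition of $(M[\frac1p],\phi)$ as a direct sum of simple isocrystals $E_{r/h}$ ($h>0$, $\gcd(r,h)=1$), where $E_{r/h}$ has a $W(k)[\frac1p]$-basis $e_0,\dots,e_{h-1}$ with $e_0\mapsto e_1\mapsto\cdots\mapsto e_{h-1}\mapsto p^r e_0$. Let $(N,\varphi)$ be the supersingular Dieudonné module of rank $2$ with $W(k)$-basis $\{x,y\}$ such that $\varphi(x)=y$ and $\varphi(y)=px$, and let $(N^d,\varphi)$ be the direct sum of $d$ copies of it. **Lemma 2.4.** Let $d\ge 1$ be an integer and let $(M,\phi)$ be a supersingular Dieudonné module over $k$ of rank $2d$. Then there exists a monomorphism $j:(N^d,\varphi)\hookrightarrow(M,\phi)$,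 i.e. an injective $W(k)$-linear map $j:N^d\to M$ with $j\circ\varphi=\phi\circ j$, such that $\phi^{d-1}(M)\subseteq j(N^d)$. In other words, if $q$ denotes the smallest integer $q\ge 0$ for which there is a monomorphism $j:(N^d,\varphi)\hookrightarrow(M,\phi)$ with $\phi^q(M)\subseteq j(N^d)$, then $q\le d-1$. -/

import Mathlib

open scoped TensorProduct

noncomputable section

namespace Dieudonne

variable (p : ℕ) [Fact p.Prime] (k : Type*) [Field k] [IsAlgClosed k] [CharP k p]

/-- The ring `W(k)` of `p`-typical Witt vectors of `k`. -/
abbrev W : Type _ := WittVector p k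

/-- The Frobenius automorphism `σ` of `W(k)`, as a ring homomorphism. -/
abbrev σ : W p k →+* W p k := WittVector.frobenius

/-- The field `W(k)[1/p]`, the fraction field of `W(k)`. -/
abbrev B : Type _ := FractionRing (W p k)

/-- The extension of `σ` to `W(k)[1/p]`. -/
abbrev σB : B p k →+* B p k := WittVector.FractionRing.frobeniusRingHom p k

/-- `σB` extends `σ`. -/
theorem σB_algebraMap (a : W p k) :
    σB p k (algebraMap (W p k) (B p k) a) = algebraMap (W p k) (B p k) (σ p k a) :=
  IsFractionRing.ringEquivOfRingEquiv_algebraMap _ a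

/-- `σB`, regarded as a `σ`-linear endomorphism of the `W(k)`-module `W(k)[1/p]`. -/
def frobB : B p k →ₛₗ[σ p k] B p k where
  toFun := σB p k
  map_add' := map_add _
  map_smul' a x := by
    rw [Algebra.smul_def, Algebra.smul_def, map_mul, σB_algebraMap]

variable {p k}

/-- `(M, φ)` is a (contravariant) Dieudonné module over `k`: `M` is a free `W(k)`-module of finite
rank and `φ` is a `σ`-linear endomorphism of `M` with `pM ⊆ φ(M)`. -/
structure IsDieudonneModule {M : Type*} [AddCommGroup M] [Module (W p k) M]
    (φ : M →ₛₗ[σ p k] M) : Prop where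
  free : Module.Free (W p k) M
  finite : Module.Finite (W p k) M
  p_smul_mem : ∀ x : M, ∃ y : M, φ y = (p : W p k) • x

/-- The `σ`-linear extension `σB ⊗ φ` of `φ` to `M[1/p] = W(k)[1/p] ⊗ M`. -/
def frobIso {M : Type*} [AddCommGroup M] [Module (W p k) M] (φ : M →ₛₗ[σ p k] M) :
    B p k ⊗[W p k] M →ₛₗ[σ p k] B p k ⊗[W p k] M :=
  TensorProduct.map (frobB p k) φ

variable (p k)

/-- The underlying space of the simple isocrystal `E_s` of slope `s = r / h` (lowest terms,
`h > 0`), of dimension `h` over `W(k)[1/p]`. -/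
abbrev SimpleIso (s : ℚ) : Type _ := Fin s.den → B p k

/-- The Frobenius of the simple isocrystal `E_s`, `s = r / h` in lowest terms. It is the
`σB`-linear map with `e_0 ↦ e_1 ↦ ⋯ ↦ e_{h-1} ↦ p ^ r e_0` on the standard basis; its `h`-th iterate
multiplies each `e_i` by `p ^ r`. -/
def frobSimple (s : ℚ) : SimpleIso p k s →ₛₗ[σB p k] SimpleIso p k s where
  toFun v i := (if (i : ℕ) = 0 then (p : B p k) ^ s.num else 1) *
    σB p k (v ((finRotate s.den).symm i))
  map_add' v w := by
    funext i
    simp only [Pi.add_apply, map_add, mul_add]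
  map_smul' a v := by
    funext i
    simp only [Pi.smul_apply, smul_eq_mul, map_mul]
    ring

variable {p k}

/-- The isocrystal `(M[1/p], φ)` is isomorphic to the direct sum of the simple isocrystals
`E_{s 0}, …, E_{s (n-1)}`; that is, `s 0, …, s (n-1)` are the slopes of the Newton polygon of
`(M, φ)`, the entry `s i` standing for `(s i).den` sides of horizontal length one. By the
Dieudonné–Manin classification each Dieudonné module over the algebraically closed field `k` has
such a list of slopes, unique up to order. -/
def HasNewtonSlopes {M : Type*} [AddCommGroup M] [Module (W p k) M] (φ : M →ₛₗ[σ p k] M)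
    {n : ℕ} (s : Fin n → ℚ) : Prop :=
  ∃ e : (B p k ⊗[W p k] M) ≃ₗ[B p k] (∀ i : Fin n, SimpleIso p k (s i)),
    ∀ x i, e (frobIso φ x) i = frobSimple p k (s i) (e x i)

/-- `(M, φ)` is a supersingular Dieudonné module: all the slopes of its Newton polygon
are `1/2`. -/
structure IsSupersingular {M : Type*} [AddCommGroup M] [Module (W p k) M]
    (φ : M →ₛₗ[σ p k] M) : Prop extends IsDieudonneModule φ where
  slopes : ∃ (n : ℕ) (s : Fin n → ℚ), HasNewtonSlopes φ s ∧ ∀ i, s i = 1 / 2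

variable (p k)

/-- The underlying module of the supersingular Dieudonné module `N` of rank two. -/
abbrev N : Type _ := Fin 2 → W p k

/-- The Frobenius of `N`: the `σ`-linear map with `x ↦ y` and `y ↦ p x` on the standard basis
`x, y` of `N`. -/
def frobN : N p k →ₛₗ[σ p k] N p k where
  toFun v := ![(p : W p k) * σ p k (v 1), σ p k (v 0)]
  map_add' v w := by
    funext i
    fin_cases i <;> simp [mul_add]
  map_smul' a v := by
    funext i
    fin_cases i
    · simp only [Pi.smul_apply, smul_eq_mul, map_mul, Fin.zero_eta, Matrix.cons_val_zero]
      ring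
    · simp

/-- The Frobenius of the direct sum `N^d`, acting componentwise. -/
def frobNPow (d : ℕ) : (Fin d → N p k) →ₛₗ[σ p k] (Fin d → N p k) where
  toFun v i := frobN p k (v i)
  map_add' v w := by
    funext i
    simp only [Pi.add_apply, map_add]
  map_smul' a v := by
    funext i
    simp only [Pi.smul_apply, map_smulₛₗ]

variable {p k}

/-- There is a monomorphism of Dieudonné modules `j : (N^d, frobNPow) ↪ (M, φ)` with
`φ^q(M) ⊆ j(N^d)`. -/
def ExistsMono {M : Type*} [AddCommGroup M] [Module (W p k) M] (φ : M →ₛₗ[σ p k] M)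
    (d q : ℕ) : Prop :=
  ∃ j : (Fin d → N p k) →ₗ[W p k] M,
    Function.Injective j ∧ (∀ v, j (frobNPow p k d v) = φ (j v)) ∧
      ∀ m : M, φ^[q] m ∈ LinearMap.range j

/-- The invariant `q` of `(M, φ)` (of rank `2d`): the smallest natural number `q` for which there is
a monomorphism `j : N^d ↪ M` with `φ^q(M) ⊆ j(N^d)`. -/
def invariantQ {M : Type*} [AddCommGroup M] [Module (W p k) M] (φ : M →ₛₗ[σ p k] M)
    (d : ℕ) : ℕ :=
  sInf {q : ℕ | ExistsMono φ d q}

end Dieudonne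

end

set_option linter.unusedSectionVars false

noncomputable section

namespace Dieudonne

variable {p : ℕ} [Fact p.Prime] {k : Type*} [Field k] [IsAlgClosed k] [CharP k p] {d : ℕ}

/-! ### Witt vectors over an algebraically closed field -/

/-! Inverting `p` turns `M` into a lattice in `E^d`, with `E` the isocrystal of slope 1/2, stable
under `F` and `V = pF⁻¹` (`IsSupersingular.exists_embedding`). Put `T = pF⁻² = VF⁻¹`; in coordinates
it is `σ⁻²`, and it commutes with `F`.

The sum `S = M + TM + ⋯ + T^(d-1) M` is already `T`-stable (`twist_mem_twistHull_self`). This goes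
by induction on `d`, projecting away one copy of `E`; inside a single copy, `F`-stability alone
implies `T`-stability (`twist_mem_of_succ_eq_zero`). Since `FT = V` preserves `M`, each `F` absorbs
one `T`, so `F^(d-1) S ⊆ M` (`iterate_frob_mem_of_mem_twistHull`).

The lattice `F^(d-1) S` contains `F^(d-1) M` and is stable under `F` and `T`. Such a lattice is a
copy of `N^d` (`IsLattice.exists_ofFixed`): it has a basis `z_i, F z_i` with `T z_i = z_i`, because
`σ² - 1` is surjective on `W(k)` (`exists_frobenius_sq_sub_self`). -/

theorem exists_frobenius_sq_sub_self_add_p_mul (c : W p k) :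
    ∃ u r : W p k, c = σ p k (σ p k u) - u + p * r := by
  have hp : 1 < p := (Fact.out : p.Prime).one_lt
  have hp2 : 1 < p * p := by nlinarith
  -- Modulo `p` the equation reads `z^(p²) - z = c₀`, which is solvable in the algebraically closed
  -- field `k`.
  let f : Polynomial k := Polynomial.X ^ (p * p) - (Polynomial.X + Polynomial.C (c.coeff 0))
  have hdeg : f.degree ≠ 0 := by
    have h : f.degree = (p * p : ℕ) := by
      rw [Polynomial.degree_sub_eq_left_of_degree_lt, Polynomial.degree_X_pow]
      rw [Polynomial.degree_X_pow, Polynomial.degree_X_add_C]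
      exact_mod_cast hp2
    rw [h]
    exact_mod_cast (by omega : p * p ≠ 0)
  obtain ⟨z, hz⟩ := IsAlgClosed.exists_root f hdeg
  have hz' : (z ^ p) ^ p - z = c.coeff 0 := by
    have : z ^ (p * p) - (z + c.coeff 0) = 0 := by simpa [f, Polynomial.IsRoot] using hz
    rw [← pow_mul]
    linear_combination this
  let u : W p k := WittVector.teichmuller p z
  have h0 : (c - (σ p k (σ p k u) - u)).coeff 0 = 0 := by
    have h := (map_sub (WittVector.constantCoeff (p := p) (R := k))
      c (σ p k (σ p k u) - u)).trans (by rw [map_sub])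
    simp only [WittVector.constantCoeff_apply] at h
    rw [h, WittVector.coeff_frobenius_charP, WittVector.coeff_frobenius_charP,
      WittVector.teichmuller_coeff_zero, hz', sub_self]
  rw [← WittVector.mem_span_p_iff_coeff_zero_eq_zero, Ideal.mem_span_singleton] at h0
  obtain ⟨r, hr⟩ := h0
  exact ⟨u, r, by rw [← hr]; ring⟩

/-- Successive approximation: `σ` fixes `p`, so the error `p * r` is corrected by solving for `r`,
and the resulting series converges `p`-adically. -/
theorem exists_frobenius_sq_sub_self (c : W p k) : ∃ u : W p k, σ p k (σ p k u) - u = c := by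
  choose u r hur using exists_frobenius_sq_sub_self_add_p_mul (p := p) (k := k)
  let s : ℕ → W p k := fun n => ∑ i ∈ Finset.range n, (p : W p k) ^ i * u (r^[i] c)
  have hs : ∀ n, c = σ p k (σ p k (s n)) - s n + (p : W p k) ^ n * r^[n] c := by
    intro n
    induction n with
    | zero => simp [s]
    | succ n ih =>
      have h1 : s (n + 1) = s n + (p : W p k) ^ n * u (r^[n] c) := Finset.sum_range_succ _ _
      rw [h1, Function.iterate_succ_apply']
      simp only [map_add, map_mul, map_pow, map_natCast]
      have h2 := hur (r^[n] c)
      linear_combination ih + (p : W p k) ^ n * h2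
  let I : Ideal (W p k) := Ideal.span {(p : W p k)}
  have hmem : ∀ n (x : W p k), x ≡ 0 [SMOD (I ^ n • ⊤ : Submodule (W p k) (W p k))] ↔
      (p : W p k) ^ n ∣ x := by
    intro n x
    rw [SModEq.zero, smul_eq_mul, Ideal.mul_top, Ideal.span_singleton_pow,
      Ideal.mem_span_singleton]
  have hmem' : ∀ n (x y : W p k), x ≡ y [SMOD (I ^ n • ⊤ : Submodule (W p k) (W p k))] ↔
      (p : W p k) ^ n ∣ x - y := by
    intro n x y
    rw [← hmem, SModEq.zero, SModEq.sub_mem]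
  obtain ⟨L, hL⟩ := IsPrecomplete.prec (I := I) (M := W p k) inferInstance (f := s) (by
    intro m n hmn
    rw [hmem', dvd_sub_comm]
    have : s n - s m = ∑ i ∈ Finset.Ico m n, (p : W p k) ^ i * u (r^[i] c) := by
      rw [Finset.sum_Ico_eq_sub _ hmn]
    rw [this]
    exact Finset.dvd_sum fun i hi => (pow_dvd_pow _ (Finset.mem_Ico.mp hi).1).mul_right _)
  refine ⟨L, sub_eq_zero.mp ?_⟩
  refine IsHausdorff.haus (I := I) (M := W p k) inferInstance _ fun n => ?_
  obtain ⟨q, hq⟩ := (hmem' n _ _).mp (hL n)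
  rw [hmem]
  refine ⟨-(σ p k (σ p k q)) + q - r^[n] c, ?_⟩
  have h1 : L = s n - (p : W p k) ^ n * q := by rw [← hq]; ring
  have h2 := hs n
  rw [h1]
  simp only [map_sub, map_mul, map_pow, map_natCast]
  linear_combination -h2

theorem algebraMap_p_ne_zero : (p : B p k) ≠ 0 := by
  have h : (algebraMap (W p k) (B p k)) (p : W p k) ≠ 0 := by
    rw [Ne, FaithfulSMul.algebraMap_eq_zero_iff]
    exact WittVector.p_nonzero p k
  simpa using h

theorem exists_eq_zpow_mul_unit {x : B p k} (hx : x ≠ 0) :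
    ∃ (m : ℤ) (u : (W p k)ˣ), x = (p : B p k) ^ m * algebraMap (W p k) (B p k) u := by
  obtain ⟨a, b, hb, rfl⟩ := IsFractionRing.div_surjective (A := W p k) x
  have hb0 : b ≠ 0 := nonZeroDivisors.ne_zero hb
  have ha0 : a ≠ 0 := by rintro rfl; simp at hx
  obtain ⟨m, u, rfl⟩ := WittVector.exists_eq_pow_p_mul' a ha0
  obtain ⟨n, v, rfl⟩ := WittVector.exists_eq_pow_p_mul' b hb0
  have hp := algebraMap_p_ne_zero (p := p) (k := k)
  have hv : algebraMap (W p k) (B p k) v ≠ 0 := by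
    rw [Ne, FaithfulSMul.algebraMap_eq_zero_iff]
    exact v.ne_zero
  have hvv : algebraMap (W p k) (B p k) v * algebraMap (W p k) (B p k) (v⁻¹ : (W p k)ˣ) = 1 := by
    rw [← map_mul, Units.mul_inv, map_one]
  refine ⟨m - n, u * v⁻¹, ?_⟩
  rw [zpow_sub₀ hp]
  simp only [map_mul, map_pow, map_natCast, Units.val_mul, zpow_natCast]
  field_simp
  linear_combination -hvv

theorem zpow_mem_range_algebraMap {m : ℤ} {w : W p k}
    (h : (p : B p k) ^ m = algebraMap (W p k) (B p k) w) : 0 ≤ m := by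
  by_contra! hm
  obtain ⟨n, hn⟩ : ∃ n : ℕ, m = -(n + 1 : ℕ) := ⟨(-m - 1).toNat, by omega⟩
  subst hn
  have hp := algebraMap_p_ne_zero (p := p) (k := k)
  rw [zpow_neg, zpow_natCast] at h
  have h1 : algebraMap (W p k) (B p k) (w * (p : W p k) ^ (n + 1)) =
      algebraMap (W p k) (B p k) 1 := by
    rw [map_mul, ← h]
    simp [hp]
  have h2 := FaithfulSMul.algebraMap_injective _ _ h1
  refine (WittVector.irreducible (k := k) p).not_isUnit ?_
  refine IsUnit.of_mul_eq_one (w * (p : W p k) ^ n) ?_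
  rw [← h2]; ring

/-! ### The isocrystal of slope one half -/

variable (p k) in
/-- The inverse of the square of the Frobenius of `W(k)`. -/
def τ : W p k →+* W p k :=
  ((WittVector.frobeniusEquiv p k).symm.trans (WittVector.frobeniusEquiv p k).symm).toRingHom

variable (p k) in
/-- The inverse of the square of the Frobenius of `W(k)[1/p]`. -/
def τB : B p k →+* B p k :=
  ((WittVector.FractionRing.frobenius p k).symm.trans
    (WittVector.FractionRing.frobenius p k).symm).toRingHom

theorem τ_σ_σ (a : W p k) : τ p k (σ p k (σ p k a)) = a := by
  change (WittVector.frobeniusEquiv p k).symm ((WittVector.frobeniusEquiv p k).symm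
    (WittVector.frobeniusEquiv p k (WittVector.frobeniusEquiv p k a))) = a
  rw [RingEquiv.symm_apply_apply, RingEquiv.symm_apply_apply]

theorem σ_σ_τ (a : W p k) : σ p k (σ p k (τ p k a)) = a := by
  change WittVector.frobeniusEquiv p k (WittVector.frobeniusEquiv p k
    ((WittVector.frobeniusEquiv p k).symm ((WittVector.frobeniusEquiv p k).symm a))) = a
  rw [RingEquiv.apply_symm_apply, RingEquiv.apply_symm_apply]

instance : RingHomSurjective (τ p k) := ⟨fun a => ⟨_, τ_σ_σ a⟩⟩

theorem τB_σB_σB (a : B p k) : τB p k (σB p k (σB p k a)) = a := by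
  change (WittVector.FractionRing.frobenius p k).symm ((WittVector.FractionRing.frobenius p k).symm
    (WittVector.FractionRing.frobenius p k (WittVector.FractionRing.frobenius p k a))) = a
  simp

theorem σB_τB_comm (a : B p k) : σB p k (τB p k a) = τB p k (σB p k a) := by
  change WittVector.FractionRing.frobenius p k ((WittVector.FractionRing.frobenius p k).symm
    ((WittVector.FractionRing.frobenius p k).symm a)) = (WittVector.FractionRing.frobenius p k).symm
    ((WittVector.FractionRing.frobenius p k).symm (WittVector.FractionRing.frobenius p k a))
  simp

theorem τB_algebraMap (a : W p k) :
    τB p k (algebraMap (W p k) (B p k) a) = algebraMap (W p k) (B p k) (τ p k a) := by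
  conv_lhs => rw [← σ_σ_τ a, ← σB_algebraMap, ← σB_algebraMap, τB_σB_σB]

variable (p k) in
/-- The isocrystal of slope `1/2`, with its standard coordinates. -/
abbrev E : Type _ := Fin 2 → B p k

variable (p k) in
/-- The Frobenius `(a, b) ↦ (p σ(b), σ(a))` of `E_{1/2} ^ d`. -/
def frob (d : ℕ) : (Fin d → E p k) →ₛₗ[σ p k] (Fin d → E p k) where
  toFun v i := ![(p : B p k) * σB p k (v i 1), σB p k (v i 0)]
  map_add' v w := by
    ext i j
    fin_cases j <;> simp [mul_add]
  map_smul' a v := by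
    ext i j
    fin_cases j
    · simp only [Pi.smul_apply, Algebra.smul_def, map_mul, σB_algebraMap]
      simp [mul_left_comm]
    · simp [Algebra.smul_def, σB_algebraMap]

variable (p k) in
/-- The operator `p F⁻²` of `E_{1/2} ^ d`, that is, `σ⁻²` in each coordinate. -/
def twist (d : ℕ) : (Fin d → E p k) →ₛₗ[τ p k] (Fin d → E p k) where
  toFun v i j := τB p k (v i j)
  map_add' v w := by
    ext i j
    simp
  map_smul' a v := by
    ext i j
    simp [Algebra.smul_def, τB_algebraMap]

theorem frob_apply_zero (v : Fin d → E p k) (i : Fin d) :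
    frob p k d v i 0 = (p : B p k) * σB p k (v i 1) := rfl

theorem frob_apply_one (v : Fin d → E p k) (i : Fin d) :
    frob p k d v i 1 = σB p k (v i 0) := rfl

theorem twist_apply (v : Fin d → E p k) (i : Fin d) (j : Fin 2) :
    twist p k d v i j = τB p k (v i j) := rfl

theorem frob_twist (v : Fin d → E p k) :
    frob p k d (twist p k d v) = twist p k d (frob p k d v) := by
  ext i j
  fin_cases j
  · simp [frob_apply_zero, twist_apply, σB_τB_comm]
  · simp [frob_apply_one, twist_apply, σB_τB_comm]

theorem twist_frob_frob (v : Fin d → E p k) :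
    twist p k d (frob p k d (frob p k d v)) = (p : W p k) • v := by
  ext i j
  fin_cases j
  · simp [frob_apply_zero, frob_apply_one, twist_apply, τB_σB_σB, Algebra.smul_def]
  · simp [frob_apply_zero, frob_apply_one, twist_apply, τB_σB_σB, Algebra.smul_def]

theorem frob_surjective (v : Fin d → E p k) : ∃ w, frob p k d w = v := by
  have hp := algebraMap_p_ne_zero (p := p) (k := k)
  let s := WittVector.FractionRing.frobenius p k
  refine ⟨fun i => ![s.symm (v i 1), s.symm ((p : B p k)⁻¹ * v i 0)], ?_⟩
  have hs : ∀ x, σB p k (s.symm x) = x := fun x => s.apply_symm_apply x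
  ext i j
  fin_cases j
  · simp only [Fin.zero_eta, frob_apply_zero, Matrix.cons_val_one, Matrix.cons_val_fin_one, hs]
    field_simp
  · simp [frob_apply_one, hs]

theorem frob_injective : Function.Injective (frob p k d) := by
  have hp := algebraMap_p_ne_zero (p := p) (k := k)
  intro v w h
  ext i j
  have h0 := congrFun (congrFun h i) 0
  have h1 := congrFun (congrFun h i) 1
  simp only [frob_apply_zero, frob_apply_one] at h0 h1
  fin_cases j
  · exact (σB p k).injective h1
  · exact (σB p k).injective (mul_left_cancel₀ hp h0)

/-! ### Vectors in a single copy of the isocrystal of slope 1/2 -/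

variable (p k) in
/-- The vector `Fⁿ(1, 0)` in `E_{1/2}`, for an integer `n`. -/
def gen (n : ℤ) : E p k :=
  if Even n then ![(p : B p k) ^ (n / 2), 0] else ![0, (p : B p k) ^ (n / 2)]

variable (p k) in
/-- The vector `Fⁿ(1, 0)` in the first summand of `E_{1/2} ^ (d + 1)`. -/
def genFst (d : ℕ) (n : ℤ) : Fin (d + 1) → E p k := Fin.cons (gen p k n) 0

theorem gen_even (m : ℤ) : gen p k (2 * m) = ![(p : B p k) ^ m, 0] := by
  simp [gen]

theorem gen_odd (m : ℤ) : gen p k (2 * m + 1) = ![0, (p : B p k) ^ m] := by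
  have h : (2 * m + 1) / 2 = m := by omega
  simp [gen, h]

theorem genFst_succ (n : ℤ) (i : Fin d) : genFst p k d n i.succ = 0 := by
  simp [genFst]

theorem frob_genFst (n : ℤ) : frob p k (d + 1) (genFst p k d n) = genFst p k d (n + 1) := by
  have hp := algebraMap_p_ne_zero (p := p) (k := k)
  ext i j
  refine Fin.cases ?_ (fun i => ?_) i
  · obtain ⟨m, rfl | rfl⟩ := Int.even_or_odd' n
    · fin_cases j <;> simp [frob_apply_zero, frob_apply_one, genFst, gen_even, gen_odd]
    · have h : 2 * m + 1 + 1 = 2 * (m + 1) := by ring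
      rw [h]
      fin_cases j
      · simp [frob_apply_zero, genFst, gen_even, gen_odd, zpow_add₀ hp, mul_comm (p : B p k)]
      · simp [frob_apply_one, genFst, gen_even, gen_odd]
  · fin_cases j <;> simp [frob_apply_zero, frob_apply_one, genFst]

theorem twist_genFst (n : ℤ) : twist p k (d + 1) (genFst p k d n) = genFst p k d n := by
  ext i j
  refine Fin.cases ?_ (fun i => ?_) i
  · obtain ⟨m, rfl | rfl⟩ := Int.even_or_odd' n
    · fin_cases j <;> simp [twist_apply, genFst, gen_even]
    · fin_cases j <;> simp [twist_apply, genFst, gen_odd]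
  · simp [twist_apply, genFst]

theorem genFst_add_two (n : ℤ) : genFst p k d (n + 1 + 1) = (p : W p k) • genFst p k d n := by
  rw [← frob_genFst, ← frob_genFst, ← twist_frob_frob, frob_genFst, frob_genFst, twist_genFst]

/-- Weigh valuation `m` as `2m` in the first coordinate and as `2m + 1` in the second. The weights
never tie; the smaller one is `n`, and its coordinate supplies the unit `a`. When the second
coordinate leads, the first is divisible by an extra `p`, whence the factor in `key1`. -/
theorem exists_eq_gen {v : E p k} (hv : v ≠ 0) : ∃ (n : ℤ) (a : (W p k)ˣ) (b : W p k),
    v = (a : W p k) • gen p k n + b • gen p k (n + 1) := by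
  have hp := algebraMap_p_ne_zero (p := p) (k := k)
  have key0 : ∀ c : W p k, v 0 ≠ 0 → v 1 = algebraMap _ (B p k) c * v 0 →
      ∃ (n : ℤ) (a : (W p k)ˣ) (b : W p k),
        v = (a : W p k) • gen p k n + b • gen p k (n + 1) := by
    intro c h0 h1
    obtain ⟨m, u, hu⟩ := exists_eq_zpow_mul_unit h0
    refine ⟨2 * m, u, c * u, ?_⟩
    rw [gen_even, gen_odd]
    ext j
    fin_cases j
    · simp [hu, Algebra.smul_def, mul_comm]
    · simp [h1, hu, Algebra.smul_def]; ring
  have key1 : ∀ c : W p k, v 1 ≠ 0 → v 0 = algebraMap _ (B p k) (p * c) * v 1 →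
      ∃ (n : ℤ) (a : (W p k)ˣ) (b : W p k),
        v = (a : W p k) • gen p k n + b • gen p k (n + 1) := by
    intro c h0 h1
    obtain ⟨m, u, hu⟩ := exists_eq_zpow_mul_unit h0
    refine ⟨2 * m + 1, u, c * u, ?_⟩
    have h : 2 * m + 1 + 1 = 2 * (m + 1) := by ring
    rw [h, gen_even, gen_odd]
    ext j
    fin_cases j
    · simp [h1, hu, Algebra.smul_def, zpow_add₀ hp]; ring
    · simp [hu, Algebra.smul_def, mul_comm]
  by_cases h0 : v 0 = 0
  · have h1 : v 1 ≠ 0 := by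
      intro h1
      apply hv
      ext j
      fin_cases j
      · exact h0
      · exact h1
    exact key1 0 h1 (by simp [h0])
  by_cases h1 : v 1 = 0
  · exact key0 0 h0 (by simp [h1])
  obtain ⟨m, u, hu⟩ := exists_eq_zpow_mul_unit h0
  obtain ⟨n, w, hw⟩ := exists_eq_zpow_mul_unit h1
  have hinv : ∀ u : (W p k)ˣ, algebraMap (W p k) (B p k) u *
      algebraMap (W p k) (B p k) (u⁻¹ : (W p k)ˣ) = 1 := fun u => by
    rw [← map_mul, Units.mul_inv, map_one]
  rcases le_or_gt m n with hmn | hmn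
  · obtain ⟨r, rfl⟩ := Int.le.dest hmn
    refine key0 ((p : W p k) ^ r * w * (u⁻¹ : (W p k)ˣ)) h0 ?_
    rw [hu, hw, zpow_add₀ hp]
    simp only [map_mul, map_pow, map_natCast, zpow_natCast]
    linear_combination -((p : B p k) ^ m * (p : B p k) ^ r * algebraMap (W p k) (B p k) w) * hinv u
  · obtain ⟨r, rfl⟩ : ∃ r : ℕ, m = n + r + 1 := ⟨(m - n - 1).toNat, by omega⟩
    refine key1 ((p : W p k) ^ r * u * (w⁻¹ : (W p k)ˣ)) h1 ?_
    rw [hu, hw, zpow_add₀ hp, zpow_add₀ hp]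
    simp only [map_mul, map_pow, map_natCast, zpow_natCast, zpow_one]
    linear_combination -((p : B p k) ^ n * (p : B p k) ^ r * p * algebraMap (W p k) (B p k) u) *
      hinv w

theorem exists_eq_genFst {v : Fin (d + 1) → E p k} (hv : v ≠ 0) (hs : ∀ i : Fin d, v i.succ = 0) :
    ∃ (n : ℤ) (a : (W p k)ˣ) (b : W p k),
      v = (a : W p k) • genFst p k d n + b • genFst p k d (n + 1) := by
  have h0 : v 0 ≠ 0 := by
    intro h0
    apply hv
    funext i
    refine Fin.cases h0 hs i
  obtain ⟨n, a, b, h⟩ := exists_eq_gen h0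
  refine ⟨n, a, b, ?_⟩
  funext i
  refine Fin.cases ?_ (fun i => ?_) i
  · simpa [genFst] using h
  · simp [hs, genFst]

/-- An `F`-stable submodule contains, with each nonzero `v` of the first summand, the whole
submodule of the first summand of elements of at least the same valuation. -/
theorem exists_genFst_mem {L : Submodule (W p k) (Fin (d + 1) → E p k)}
    (hF : ∀ x ∈ L, frob p k (d + 1) x ∈ L) {v : Fin (d + 1) → E p k} (hvL : v ∈ L) (hv : v ≠ 0)
    (hs : ∀ i : Fin d, v i.succ = 0) :
    ∃ (n : ℤ) (a b : W p k), genFst p k d n ∈ L ∧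
      v = a • genFst p k d n + b • genFst p k d (n + 1) := by
  obtain ⟨n, a, b, h⟩ := exists_eq_genFst hv hs
  refine ⟨n, a, b, ?_, h⟩
  have hFv : frob p k (d + 1) v = σ p k a • genFst p k d (n + 1) +
      (p * σ p k b) • genFst p k d n := by
    rw [h, map_add, map_smulₛₗ, map_smulₛₗ, frob_genFst, frob_genFst, genFst_add_two, smul_smul,
      mul_comm (p : W p k)]
  -- This is the determinant of the pair `v`, `F v` in terms of the two generators. It is a unit
  -- modulo `p`, so Cramer's rule recovers `genFst p k d n`.
  have hdet : IsUnit ((a : W p k) * σ p k a - p * (b * σ p k b)) := by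
    apply WittVector.isUnit_of_coeff_zero_ne_zero
    have hu : IsUnit ((a : W p k) * σ p k a) := a.isUnit.mul (a.isUnit.map (σ p k))
    have h1 := hu.map (WittVector.constantCoeff (p := p) (R := k))
    have h2 : WittVector.constantCoeff ((p : W p k) * (b * σ p k b)) = 0 := by
      rw [WittVector.constantCoeff_apply, ← WittVector.mem_span_p_iff_coeff_zero_eq_zero,
        Ideal.mem_span_singleton]
      exact dvd_mul_right _ _
    rw [← WittVector.constantCoeff_apply, map_sub, h2, sub_zero]
    exact h1.ne_zero
  obtain ⟨D, hD⟩ := hdet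
  have h3 : (D : W p k) • genFst p k d n = σ p k a • v - b • frob p k (d + 1) v := by
    rw [hFv, h, hD]
    module
  have h4 : genFst p k d n = ((D⁻¹ : (W p k)ˣ) : W p k) • (σ p k a • v - b • frob p k (d + 1) v) := by
    rw [← h3, smul_smul, Units.inv_mul, one_smul]
  rw [h4]
  exact L.smul_mem _ (L.sub_mem (L.smul_mem _ hvL) (L.smul_mem _ (hF _ hvL)))

/-- The two generators produced by `v` lie in `L` and are fixed by `T`, which therefore only changes
the coefficients of `v`. -/
theorem twist_mem_of_succ_eq_zero {L : Submodule (W p k) (Fin (d + 1) → E p k)}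
    (hF : ∀ x ∈ L, frob p k (d + 1) x ∈ L) {v : Fin (d + 1) → E p k} (hvL : v ∈ L)
    (hs : ∀ i : Fin d, v i.succ = 0) : twist p k (d + 1) v ∈ L := by
  by_cases hv : v = 0
  · rw [hv, map_zero]
    exact L.zero_mem
  obtain ⟨n, a, b, hn, rfl⟩ := exists_genFst_mem hF hvL hv hs
  rw [map_add, map_smulₛₗ, map_smulₛₗ, twist_genFst, twist_genFst]
  refine L.add_mem (L.smul_mem _ hn) (L.smul_mem _ ?_)
  rw [← frob_genFst]
  exact hF _ hn

/-! ### The smallest superspecial module containing a Dieudonné module -/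

variable (p k) in
/-- The projection of `E_{1/2} ^ (d + 1)` to its last `d` summands. -/
def tail (d : ℕ) : (Fin (d + 1) → E p k) →ₗ[W p k] (Fin d → E p k) :=
  LinearMap.funLeft (W p k) (E p k) Fin.succ

theorem tail_apply (v : Fin (d + 1) → E p k) (i : Fin d) : tail p k d v i = v i.succ := rfl

theorem tail_frob (v : Fin (d + 1) → E p k) :
    tail p k d (frob p k (d + 1) v) = frob p k d (tail p k d v) := rfl

theorem tail_twist (v : Fin (d + 1) → E p k) :
    tail p k d (twist p k (d + 1) v) = twist p k d (tail p k d v) := rfl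

/-- The submodule `∑ Tⁱ M` (`i < n`), where `T = p F⁻²`. -/
def twistHull (M : Submodule (W p k) (Fin d → E p k)) : ℕ → Submodule (W p k) (Fin d → E p k)
  | 0 => ⊥
  | n + 1 => M ⊔ (twistHull M n).map (twist p k d)

theorem twistHull_mono (M : Submodule (W p k) (Fin d → E p k)) (n : ℕ) :
    twistHull M n ≤ twistHull M (n + 1) := by
  induction n with
  | zero => exact bot_le
  | succ n ih => exact sup_le_sup_left (Submodule.map_mono ih) _

theorem twist_mem_twistHull {M : Submodule (W p k) (Fin d → E p k)} {n : ℕ} {x : Fin d → E p k}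
    (hx : x ∈ twistHull M n) : twist p k d x ∈ twistHull M (n + 1) :=
  Submodule.mem_sup_right (Submodule.mem_map_of_mem hx)

theorem frob_mem_twistHull {M : Submodule (W p k) (Fin d → E p k)}
    (hF : ∀ x ∈ M, frob p k d x ∈ M) (n : ℕ) :
    ∀ x ∈ twistHull M n, frob p k d x ∈ twistHull M n := by
  induction n with
  | zero =>
    intro x hx
    rw [(Submodule.mem_bot _).mp hx, map_zero]
    exact Submodule.zero_mem _
  | succ n ih =>
    intro x hx
    obtain ⟨m, hm, _, ⟨y, hy, rfl⟩, rfl⟩ := Submodule.mem_sup.mp hx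
    rw [map_add, frob_twist]
    exact Submodule.add_mem _ (Submodule.mem_sup_left (hF _ hm)) (twist_mem_twistHull (ih y hy))

theorem map_tail_twistHull (M : Submodule (W p k) (Fin (d + 1) → E p k)) (n : ℕ) :
    (twistHull M n).map (tail p k d) = twistHull (M.map (tail p k d)) n := by
  induction n with
  | zero => exact Submodule.map_bot _
  | succ n ih =>
    change (M ⊔ _).map _ = _ ⊔ _
    rw [Submodule.map_sup, ← ih]
    congr 1
    ext x
    constructor
    · rintro ⟨_, ⟨y, hy, rfl⟩, rfl⟩
      exact ⟨_, ⟨y, hy, rfl⟩, rfl⟩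
    · rintro ⟨_, ⟨y, hy, rfl⟩, rfl⟩
      exact ⟨_, ⟨y, hy, rfl⟩, rfl⟩

/-- For an `F`-stable submodule `M` of `E_{1/2} ^ d`, the sum `∑ Tⁱ M` (`i < d`) is stable
under `T = p F⁻²`. -/
theorem twist_mem_twistHull_self : ∀ {d : ℕ} {M : Submodule (W p k) (Fin d → E p k)},
    (∀ x ∈ M, frob p k d x ∈ M) → ∀ x ∈ twistHull M d, twist p k d x ∈ twistHull M d := by
  intro d
  induction d with
  | zero =>
    intro M _ x _
    rw [Subsingleton.elim (twist p k 0 x) 0]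
    exact Submodule.zero_mem _
  | succ d ih =>
    intro M hF x hx
    have hF' : ∀ x ∈ M.map (tail p k d), frob p k d x ∈ M.map (tail p k d) := by
      rintro _ ⟨y, hy, rfl⟩
      exact ⟨_, hF y hy, rfl⟩
    -- By induction the tail of `T y` lies in the tail of `twistHull M d`, so `T y = u + m` with `m`
    -- in that hull and `u` in the first summand. The rank-one case handles `T u`; `T m` is in the
    -- next hull by construction.
    have hstep : ∀ y ∈ twistHull M d,
        twist p k (d + 1) (twist p k (d + 1) y) ∈ twistHull M (d + 1) := by
      intro y hy
      have h1 : tail p k d (twist p k (d + 1) y) ∈ (twistHull M d).map (tail p k d) := by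
        rw [map_tail_twistHull, tail_twist]
        refine ih hF' _ ?_
        rw [← map_tail_twistHull]
        exact Submodule.mem_map_of_mem hy
      obtain ⟨m, hm, hmy⟩ := h1
      have hu : twist p k (d + 1) (twist p k (d + 1) y - m) ∈ twistHull M (d + 1) := by
        refine twist_mem_of_succ_eq_zero (frob_mem_twistHull hF _)
          (Submodule.sub_mem _ (twist_mem_twistHull hy) (twistHull_mono M d hm)) fun i => ?_
        rw [← tail_apply (twist p k (d + 1) y - m), map_sub, hmy, sub_self, Pi.zero_apply]
      have h2 := Submodule.add_mem _ hu (twist_mem_twistHull hm)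
      rwa [map_sub, sub_add_cancel] at h2
    obtain ⟨m, hm, _, ⟨y, hy, rfl⟩, rfl⟩ := Submodule.mem_sup.mp hx
    rw [map_add]
    refine Submodule.add_mem _ ?_ (hstep y hy)
    -- With one summand the hull is `M` itself and has no room for `T m`, so the rank-one case is
    -- needed; otherwise `T m` is one of the terms.
    cases d with
    | zero =>
      exact twist_mem_of_succ_eq_zero (frob_mem_twistHull hF (0 + 1))
        (Submodule.mem_sup_left hm) (fun i => i.elim0)
    | succ d => exact twist_mem_twistHull (Submodule.mem_sup_left hm)

/-- `FT = pF⁻¹ = V`, and `hV` says that `V` preserves `M`; hence each application of `F` cancels one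
`T`. -/
theorem iterate_frob_mem_of_mem_twistHull {M : Submodule (W p k) (Fin d → E p k)}
    (hF : ∀ x ∈ M, frob p k d x ∈ M)
    (hV : ∀ x ∈ M, ∃ y ∈ M, frob p k d y = (p : W p k) • x) (n : ℕ) :
    ∀ x ∈ twistHull M (n + 1), (frob p k d)^[n] x ∈ M := by
  have hFn : ∀ n, ∀ x ∈ M, (frob p k d)^[n] x ∈ M := fun n => by
    induction n with
    | zero => exact fun x hx => hx
    | succ n ih => exact fun x hx => ih _ (hF x hx)
  have hadd : ∀ n (x y : Fin d → E p k), (frob p k d)^[n] (x + y) =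
      (frob p k d)^[n] x + (frob p k d)^[n] y := fun n => by
    induction n with
    | zero => exact fun _ _ => rfl
    | succ n ih => intro x y; simp only [Function.iterate_succ_apply, map_add, ih]
  have hcomm : ∀ n (x : Fin d → E p k), (frob p k d)^[n] (twist p k d x) =
      twist p k d ((frob p k d)^[n] x) := fun n => by
    induction n with
    | zero => exact fun _ => rfl
    | succ n ih => intro x; simp only [Function.iterate_succ_apply, frob_twist, ih]
  induction n with
  | zero =>
    intro x hx
    have h : twistHull M 1 = M := by
      change M ⊔ (⊥ : Submodule (W p k) (Fin d → E p k)).map (twist p k d) = M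
      rw [Submodule.map_bot, sup_bot_eq]
    rwa [h] at hx
  | succ n ih =>
    intro x hx
    obtain ⟨m, hm, _, ⟨y, hy, rfl⟩, rfl⟩ := Submodule.mem_sup.mp hx
    rw [hadd]
    refine M.add_mem (hFn _ _ hm) ?_
    obtain ⟨z, hz, hzy⟩ := hV _ (ih y hy)
    rw [Function.iterate_succ_apply', hcomm, frob_twist]
    suffices h : twist p k d (frob p k d ((frob p k d)^[n] y)) = z by rwa [h]
    apply frob_injective
    rw [hzy, frob_twist, twist_frob_frob]

/-! ### The structure of superspecial lattices -/

variable (p k) in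
/-- The standard lattice in `E_{1/2} ^ d`. -/
def stdLattice (d : ℕ) : Submodule (W p k) (Fin d → E p k) where
  carrier := {v | ∀ i j, v i j ∈ (algebraMap (W p k) (B p k)).range}
  add_mem' hv hw i j := add_mem (hv i j) (hw i j)
  zero_mem' _ _ := zero_mem _
  smul_mem' a v hv i j := by
    rw [Pi.smul_apply, Pi.smul_apply, Algebra.smul_def]
    exact mul_mem ⟨a, rfl⟩ (hv i j)

/-- A submodule of `E_{1/2} ^ d` is a lattice: it is commensurable with the standard one. -/
structure IsLattice (L : Submodule (W p k) (Fin d → E p k)) : Prop where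
  bounded : ∃ n : ℕ, ∀ v ∈ L, (p : W p k) ^ n • v ∈ stdLattice p k d
  full : ∀ v, ∃ n : ℕ, (p : W p k) ^ n • v ∈ L

theorem IsLattice.map_tail {L : Submodule (W p k) (Fin (d + 1) → E p k)} (hL : IsLattice L) :
    IsLattice (L.map (tail p k d)) where
  bounded := by
    obtain ⟨n, hn⟩ := hL.bounded
    refine ⟨n, ?_⟩
    rintro _ ⟨v, hv, rfl⟩ i j
    exact hn v hv i.succ j
  full v := by
    obtain ⟨n, hn⟩ := hL.full (Fin.cons 0 v)
    exact ⟨n, _, hn, rfl⟩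

/-- Boundedness yields a least `n` with `genFst p k d n ∈ L`. All later generators are combinations
of the first two, since `F² = p` on them. -/
theorem IsLattice.exists_genFst {L : Submodule (W p k) (Fin (d + 1) → E p k)} (hL : IsLattice L)
    (hF : ∀ x ∈ L, frob p k (d + 1) x ∈ L) :
    ∃ n : ℤ, genFst p k d n ∈ L ∧ ∀ v ∈ L, (∀ i : Fin d, v i.succ = 0) →
      ∃ a b : W p k, v = a • genFst p k d n + b • genFst p k d (n + 1) := by
  have hp := algebraMap_p_ne_zero (p := p) (k := k)
  have hbdd : ∃ b : ℤ, ∀ n : ℤ, genFst p k d n ∈ L → b ≤ n := by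
    obtain ⟨N, hN⟩ := hL.bounded
    refine ⟨-(2 * N), fun n hn => ?_⟩
    have h := hN _ hn 0
    obtain ⟨m, rfl | rfl⟩ := Int.even_or_odd' n
    · obtain ⟨w, hw⟩ := h 0
      have h1 : (p : B p k) ^ (N + m : ℤ) = algebraMap (W p k) (B p k) w := by
        rw [hw, zpow_add₀ hp]
        simp [genFst, gen_even, Algebra.smul_def]
      have := zpow_mem_range_algebraMap h1
      omega
    · obtain ⟨w, hw⟩ := h 1
      have h1 : (p : B p k) ^ (N + m : ℤ) = algebraMap (W p k) (B p k) w := by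
        rw [hw, zpow_add₀ hp]
        simp [genFst, gen_odd, Algebra.smul_def]
      have := zpow_mem_range_algebraMap h1
      omega
  have hne : ∃ n : ℤ, genFst p k d n ∈ L := by
    obtain ⟨N, hN⟩ := hL.full (genFst p k d 0)
    refine ⟨2 * N, ?_⟩
    convert hN using 1
    clear hN
    induction N with
    | zero => simp
    | succ N ih =>
      have h1 : 2 * ((N + 1 : ℕ) : ℤ) = 2 * N + 1 + 1 := by push_cast; ring
      rw [pow_succ', mul_smul, ← ih, ← genFst_add_two, h1]
  obtain ⟨n, hn, hmin⟩ := Int.exists_least_of_bdd hbdd hne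
  refine ⟨n, hn, fun v hv hs => ?_⟩
  have hadd : ∀ r : ℕ, ∃ a b : W p k,
      genFst p k d (n + r) = a • genFst p k d n + b • genFst p k d (n + 1) := by
    intro r
    induction r with
    | zero => exact ⟨1, 0, by simp⟩
    | succ r ih =>
      obtain ⟨a, b, hab⟩ := ih
      refine ⟨σ p k b * p, σ p k a, ?_⟩
      have h1 : n + ((r + 1 : ℕ) : ℤ) = n + r + 1 := by push_cast; ring
      rw [h1, ← frob_genFst, hab, map_add, map_smulₛₗ, map_smulₛₗ, frob_genFst, frob_genFst,
        genFst_add_two, smul_smul, add_comm (_ • _)]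
  by_cases hv0 : v = 0
  · exact ⟨0, 0, by simp [hv0]⟩
  obtain ⟨m, a, b, hm, rfl⟩ := exists_genFst_mem hF hv hv0 hs
  obtain ⟨r, rfl⟩ := Int.le.dest (hmin m hm)
  obtain ⟨a0, b0, h0⟩ := hadd r
  obtain ⟨a1, b1, h1⟩ := hadd (r + 1)
  have h2 : n + ((r + 1 : ℕ) : ℤ) = n + r + 1 := by push_cast; ring
  rw [h2] at h1
  refine ⟨a * a0 + b * a1, a * b0 + b * b1, ?_⟩
  rw [h1, h0]
  module

/-- The `W(k)`-linear map `N ^ d → E_{1/2} ^ d` that sends the `i`-th copies of `x`, `y` to `z i`,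
`F (z i)`. -/
def ofFixed (z : Fin d → Fin d → E p k) : (Fin d → N p k) →ₗ[W p k] (Fin d → E p k) where
  toFun w := ∑ i, (w i 0 • z i + w i 1 • frob p k d (z i))
  map_add' v w := by
    rw [← Finset.sum_add_distrib]
    refine Finset.sum_congr rfl fun i _ => ?_
    simp only [Pi.add_apply]
    module
  map_smul' a w := by
    rw [Finset.smul_sum]
    refine Finset.sum_congr rfl fun i _ => ?_
    simp only [Pi.smul_apply, RingHom.id_apply, smul_eq_mul]
    module

theorem ofFixed_apply (z : Fin d → Fin d → E p k) (w : Fin d → N p k) :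
    ofFixed z w = ∑ i, (w i 0 • z i + w i 1 • frob p k d (z i)) := rfl

theorem frob_frob_of_twist_eq {v : Fin d → E p k} (hv : twist p k d v = v) :
    frob p k d (frob p k d v) = (p : W p k) • v := by
  conv_lhs => rw [← hv]
  rw [frob_twist, frob_twist, twist_frob_frob]

theorem ofFixed_frobNPow {z : Fin d → Fin d → E p k} (hz : ∀ i, twist p k d (z i) = z i)
    (w : Fin d → N p k) : ofFixed z (frobNPow p k d w) = frob p k d (ofFixed z w) := by
  rw [ofFixed_apply, ofFixed_apply, map_sum]
  refine Finset.sum_congr rfl fun i _ => ?_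
  have h0 : frobNPow p k d w i 0 = p * σ p k (w i 1) := rfl
  have h1 : frobNPow p k d w i 1 = σ p k (w i 0) := rfl
  rw [map_add, map_smulₛₗ, map_smulₛₗ, frob_frob_of_twist_eq (hz i), smul_smul, h0, h1,
    mul_comm (p : W p k), add_comm]

theorem exists_twist_sub_self (n : ℤ) (a b : W p k) : ∃ c e : W p k,
    twist p k (d + 1) (c • genFst p k d n + e • genFst p k d (n + 1)) -
      (c • genFst p k d n + e • genFst p k d (n + 1)) =
    a • genFst p k d n + b • genFst p k d (n + 1) := by
  have h : ∀ a : W p k, ∃ c, τ p k c - c = a := fun a => by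
    obtain ⟨u, hu⟩ := exists_frobenius_sq_sub_self (-a)
    -- If `σ² u - u = -a`, then `c = σ² u` satisfies `τ c - c = u - σ² u = a`.
    refine ⟨σ p k (σ p k u), ?_⟩
    rw [τ_σ_σ]
    linear_combination -hu
  obtain ⟨c, hc⟩ := h a
  obtain ⟨e, he⟩ := h b
  refine ⟨c, e, ?_⟩
  rw [map_add, map_smulₛₗ, map_smulₛₗ, twist_genFst, twist_genFst, ← hc, ← he]
  module

theorem genFst_linearIndependent {n : ℤ} {a b : W p k}
    (h : a • genFst p k d n + b • genFst p k d (n + 1) = 0) : a = 0 ∧ b = 0 := by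
  have hp := algebraMap_p_ne_zero (p := p) (k := k)
  have h0 := congrFun (congrFun h 0) 0
  have h1 := congrFun (congrFun h 0) 1
  obtain ⟨m, rfl | rfl⟩ := Int.even_or_odd' n
  · simp [genFst, gen_even, gen_odd, Algebra.smul_def, hp, zpow_ne_zero] at h0 h1
    exact ⟨h0, h1⟩
  · have h2 : 2 * m + 1 + 1 = 2 * (m + 1) := by ring
    rw [h2] at h0 h1
    simp [genFst, gen_even, gen_odd, Algebra.smul_def, hp, zpow_ne_zero] at h0 h1
    exact ⟨h1, h0⟩

/-- A lattice stable under `F` and `T = p F⁻²` is isomorphic to `N ^ d`. -/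
theorem IsLattice.exists_ofFixed : ∀ {d : ℕ} {L : Submodule (W p k) (Fin d → E p k)},
    IsLattice L → (∀ x ∈ L, frob p k d x ∈ L) → (∀ x ∈ L, twist p k d x ∈ L) →
    ∃ z : Fin d → Fin d → E p k, (∀ i, twist p k d (z i) = z i) ∧
      Function.Injective (ofFixed z) ∧ LinearMap.range (ofFixed z) = L := by
  intro d
  induction d with
  | zero =>
    intro L _ _ _
    exact ⟨fun i => i.elim0, fun i => i.elim0, fun _ _ _ => Subsingleton.elim _ _,
      Subsingleton.elim _ _⟩
  | succ d ih =>
    intro L hL hF hT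
    obtain ⟨z, hzT, hzinj, hzL⟩ := ih hL.map_tail
      (by rintro _ ⟨x, hx, rfl⟩; exact ⟨_, hF x hx, rfl⟩)
      (by rintro _ ⟨x, hx, rfl⟩; exact ⟨_, hT x hx, rfl⟩)
    obtain ⟨n, hn, hgen⟩ := hL.exists_genFst hF
    have hn1 : genFst p k d (n + 1) ∈ L := by
      rw [← frob_genFst]
      exact hF _ hn
    -- For any lift `x` in `L`, `T x - x` lies in the part of `L` in the first summand. There `T -
    -- 1` is surjective, so `x` can be corrected to a fixed vector without changing its tail.
    have hlift : ∀ i, ∃ y ∈ L, twist p k (d + 1) y = y ∧ tail p k d y = z i := by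
      intro i
      have hzi : z i ∈ L.map (tail p k d) := by
        rw [← hzL]
        refine ⟨Pi.single i ![1, 0], ?_⟩
        rw [ofFixed_apply, Finset.sum_eq_single i]
        · simp
        · intro j _ hj
          simp [Pi.single_eq_of_ne hj]
        · simp
      obtain ⟨x, hx, hxi⟩ := hzi
      obtain ⟨a, b, hab⟩ := hgen _ (L.sub_mem (hT x hx) hx) fun j => by
        rw [← tail_apply (_ - x), map_sub, tail_twist, hxi, hzT, sub_self, Pi.zero_apply]
      obtain ⟨c, e, hce⟩ := exists_twist_sub_self (d := d) n a b
      rw [← hab] at hce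
      refine ⟨x - (c • genFst p k d n + e • genFst p k d (n + 1)), L.sub_mem hx
        (L.add_mem (L.smul_mem _ hn) (L.smul_mem _ hn1)), ?_, ?_⟩
      · rw [map_sub, sub_eq_sub_iff_sub_eq_sub]
        exact hce.symm
      · rw [map_sub, hxi, sub_eq_self]
        funext j
        simp [tail_apply, genFst_succ]
    choose y hyL hyT hyz using hlift
    let z' : Fin (d + 1) → Fin (d + 1) → E p k := Fin.cons (genFst p k d n) y
    have hz' : ∀ w, ofFixed z' w = (w 0 0 • genFst p k d n + w 0 1 • genFst p k d (n + 1)) +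
        ∑ i : Fin d, (w i.succ 0 • y i + w i.succ 1 • frob p k (d + 1) (y i)) := by
      intro w
      rw [ofFixed_apply, Fin.sum_univ_succ]
      simp [z', frob_genFst]
    have htail : ∀ w, tail p k d (ofFixed z' w) = ofFixed z (fun i => w i.succ) := by
      intro w
      rw [hz', map_add, map_sum]
      have h0 : tail p k d (w 0 0 • genFst p k d n + w 0 1 • genFst p k d (n + 1)) = 0 := by
        funext j
        simp [tail_apply, genFst_succ]
      rw [h0, zero_add, ofFixed_apply]
      refine Finset.sum_congr rfl fun i _ => ?_
      rw [map_add, map_smul, map_smul, tail_frob, hyz]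
    have hmem : ∀ w, ofFixed z' w ∈ L := by
      intro w
      rw [hz']
      exact L.add_mem (L.add_mem (L.smul_mem _ hn) (L.smul_mem _ hn1))
        (L.sum_mem fun i _ => L.add_mem (L.smul_mem _ (hyL i)) (L.smul_mem _ (hF _ (hyL i))))
    refine ⟨z', ?_, ?_, le_antisymm ?_ ?_⟩
    · intro i
      refine Fin.cases ?_ (fun i => ?_) i
      · exact twist_genFst n
      · exact hyT i
    · rw [injective_iff_map_eq_zero]
      intro w hw
      have h1 := htail w
      rw [hw, map_zero] at h1
      have h2 := (injective_iff_map_eq_zero _).mp hzinj _ h1.symm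
      have h3 : ∀ i : Fin d, w i.succ = 0 := fun i => congrFun h2 i
      rw [hz'] at hw
      simp only [h3, Pi.zero_apply, zero_smul, add_zero, Finset.sum_const_zero] at hw
      obtain ⟨h4, h5⟩ := genFst_linearIndependent hw
      funext i
      refine Fin.cases ?_ h3 i
      funext j
      fin_cases j
      · exact h4
      · exact h5
    · rintro _ ⟨w, rfl⟩
      exact hmem w
    · intro x hx
      have hx' : tail p k d x ∈ LinearMap.range (ofFixed z) := by
        rw [hzL]
        exact Submodule.mem_map_of_mem hx
      obtain ⟨w, hw⟩ := hx'
      -- Subtracting the combination of lifted vectors with the same tail leaves an element of the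
      -- first summand, which determines the missing two coefficients.
      let w' : Fin (d + 1) → N p k := Fin.cons 0 w
      obtain ⟨a, b, hab⟩ := hgen _ (L.sub_mem hx (hmem w')) fun j => by
        rw [← tail_apply (x - _), map_sub, htail, ← hw]
        simp [w']
      refine ⟨Fin.cons ![a, b] w, ?_⟩
      have h6 : ofFixed z' (Fin.cons ![a, b] w) =
          (a • genFst p k d n + b • genFst p k d (n + 1)) + ofFixed z' w' := by
        rw [hz', hz']
        simp [w']
      rw [h6, ← hab, sub_add_cancel]

/-! ### Supersingular Dieudonné modules as lattices -/

theorem exists_simpleIso_equiv {s : ℚ} (hs : s = 1 / 2) : ∃ c : SimpleIso p k s ≃ₗ[B p k] E p k,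
    ∀ v, c (frobSimple p k s v) = ![(p : B p k) * σB p k (c v 1), σB p k (c v 0)] := by
  subst hs
  have hden : (1 / 2 : ℚ).den = 2 := by norm_num
  have hnum : (1 / 2 : ℚ).num = 1 := by norm_num
  -- A variable `h` allows the denominator to be replaced by the literal 2, where the rotation is
  -- the swap.
  have hrot : ∀ (h : ℕ) (hh : 2 = h), (finRotate h).symm (finCongr hh 0) = finCongr hh 1 ∧
      (finRotate h).symm (finCongr hh 1) = finCongr hh 0 := by
    rintro h rfl
    decide
  refine ⟨LinearEquiv.funCongrLeft (B p k) (B p k) (finCongr hden.symm), fun v => ?_⟩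
  ext j
  rw [LinearEquiv.funCongrLeft_apply, LinearMap.funLeft_apply]
  change (if _ then _ else _) * σB p k (v _) = _
  fin_cases j
  · simp only [Fin.zero_eta, (hrot _ hden.symm).1]
    rw [hnum]
    simp [LinearMap.funLeft_apply]
  · simp only [Fin.mk_one, (hrot _ hden.symm).2]
    simp [LinearMap.funLeft_apply]

theorem exists_pow_mul_eq (x : B p k) :
    ∃ (n : ℕ) (w : W p k), (p : B p k) ^ n * x = algebraMap (W p k) (B p k) w := by
  have hp := algebraMap_p_ne_zero (p := p) (k := k)
  by_cases hx : x = 0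
  · exact ⟨0, 0, by simp [hx]⟩
  obtain ⟨m, u, rfl⟩ := exists_eq_zpow_mul_unit hx
  refine ⟨m.natAbs, p ^ (m.natAbs + m).toNat * u, ?_⟩
  rw [← mul_assoc, ← zpow_natCast, ← zpow_add₀ hp, map_mul, map_pow, map_natCast, ← zpow_natCast,
    Int.toNat_of_nonneg (by omega)]

theorem pow_smul_mem_stdLattice_of_le {v : Fin d → E p k} {m n : ℕ} (hmn : m ≤ n)
    (h : (p : W p k) ^ m • v ∈ stdLattice p k d) : (p : W p k) ^ n • v ∈ stdLattice p k d := by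
  obtain ⟨r, rfl⟩ := Nat.exists_eq_add_of_le' hmn
  rw [pow_add, mul_smul]
  exact Submodule.smul_mem _ _ h

theorem exists_pow_smul_mem_stdLattice (v : Fin d → E p k) :
    ∃ n : ℕ, (p : W p k) ^ n • v ∈ stdLattice p k d := by
  choose n w h using fun i j => exists_pow_mul_eq (v i j)
  refine ⟨∑ i, ∑ j, n i j, fun i j => ?_⟩
  have hle : n i j ≤ ∑ i, ∑ j, n i j :=
    (Finset.single_le_sum (f := fun j => n i j) (fun _ _ => Nat.zero_le _)
      (Finset.mem_univ j)).trans
    (Finset.single_le_sum (f := fun i => ∑ j, n i j) (fun _ _ => Nat.zero_le _)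
      (Finset.mem_univ i))
  obtain ⟨r, hr⟩ := Nat.exists_eq_add_of_le' hle
  refine ⟨p ^ r * w i j, ?_⟩
  rw [map_mul, ← h, hr]
  simp [Algebra.smul_def, pow_add, mul_assoc]

variable {M : Type*} [AddCommGroup M] [Module (W p k) M]

theorem exists_pow_smul_eq_tmul (t : B p k ⊗[W p k] M) :
    ∃ (n : ℕ) (m : M), (p : W p k) ^ n • t = (1 : B p k) ⊗ₜ[W p k] m := by
  induction t with
  | zero => exact ⟨0, 0, by simp⟩
  | tmul b m =>
    obtain ⟨n, w, h⟩ := exists_pow_mul_eq b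
    refine ⟨n, w • m, ?_⟩
    rw [TensorProduct.smul_tmul', ← TensorProduct.smul_tmul, Algebra.smul_def, Algebra.smul_def,
      ← h, mul_one, map_pow, map_natCast]
  | add s t hs ht =>
    obtain ⟨a, x, hx⟩ := hs
    obtain ⟨b, y, hy⟩ := ht
    refine ⟨a + b, (p : W p k) ^ b • x + (p : W p k) ^ a • y, ?_⟩
    rw [TensorProduct.tmul_add, TensorProduct.tmul_smul, TensorProduct.tmul_smul, ← hx, ← hy,
      smul_smul, smul_smul, smul_add, pow_add, mul_comm ((p : W p k) ^ b)]

/-- Flatness of `M` makes `M → M[1/p]` injective. Finite generation bounds the denominators, and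
clearing denominators in `M[1/p]` gives fullness. -/
theorem IsSupersingular.exists_embedding {φ : M →ₛₗ[σ p k] M} (hφ : IsSupersingular φ)
    (hrank : Module.finrank (W p k) M = 2 * d) :
    ∃ ι : M →ₗ[W p k] (Fin d → E p k), Function.Injective ι ∧
      (∀ m, ι (φ m) = frob p k d (ι m)) ∧ IsLattice (LinearMap.range ι) := by
  have := hφ.free
  have := hφ.finite
  obtain ⟨n, s, ⟨e, he⟩, hs⟩ := hφ.slopes
  choose c hc using fun i => exists_simpleIso_equiv (p := p) (k := k) (hs i)
  let ε : (B p k ⊗[W p k] M) ≃ₗ[B p k] (Fin n → E p k) := e.trans (LinearEquiv.piCongrRight c)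
  -- Each simple summand of slope 1/2 has dimension 2.
  have hn : n = d := by
    have h1 := ε.finrank_eq
    rw [Module.finrank_baseChange, hrank, Module.finrank_pi_fintype] at h1
    simp at h1
    omega
  subst hn
  let ι : M →ₗ[W p k] (Fin n → E p k) :=
    (ε.toLinearMap.restrictScalars (W p k)).comp (TensorProduct.mk (W p k) (B p k) M 1)
  have hι : ∀ m, ι m = ε (1 ⊗ₜ m) := fun m => rfl
  refine ⟨ι, ?_, ?_, ?_, ?_⟩
  · have h1 := Module.Flat.rTensor_preserves_injective_linearMap (M := M)
      (Algebra.linearMap (W p k) (B p k)) (FaithfulSMul.algebraMap_injective _ _)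
    intro x y hxy
    rw [hι, hι] at hxy
    have h2 := ε.injective hxy
    have h3 : (1 : W p k) ⊗ₜ[W p k] x = 1 ⊗ₜ y := h1 (by simpa using h2)
    simpa using congrArg (TensorProduct.lid (W p k) M) h3
  · intro m
    have h1 : frobIso φ (1 ⊗ₜ m) = 1 ⊗ₜ φ m := by
      change frobB p k 1 ⊗ₜ φ m = _
      congr 1
      exact map_one (σB p k)
    rw [hι, hι, ← h1]
    funext i
    change c i (e (frobIso φ (1 ⊗ₜ m)) i) = _
    rw [he, hc]
    rfl
  · have h1 := Submodule.fg_induction (R := W p k) (M := M)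
      (motive := fun P _ => ∃ n : ℕ, ∀ v ∈ P, (p : W p k) ^ n • ι v ∈ stdLattice p k _)
      (fun x => by
        obtain ⟨n, hn⟩ := exists_pow_smul_mem_stdLattice (ι x)
        refine ⟨n, fun v hv => ?_⟩
        obtain ⟨a, rfl⟩ := Submodule.mem_span_singleton.mp hv
        rw [map_smul, smul_comm]
        exact Submodule.smul_mem _ _ hn)
      (fun P Q _ _ hP hQ => by
        obtain ⟨a, ha⟩ := hP
        obtain ⟨b, hb⟩ := hQ
        refine ⟨max a b, fun v hv => ?_⟩
        obtain ⟨x, hx, y, hy, rfl⟩ := Submodule.mem_sup.mp hv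
        rw [map_add, smul_add]
        exact Submodule.add_mem _ (pow_smul_mem_stdLattice_of_le (le_max_left _ _) (ha x hx))
          (pow_smul_mem_stdLattice_of_le (le_max_right _ _) (hb y hy)))
      ⊤ Module.Finite.fg_top
    obtain ⟨N, hN⟩ := h1
    refine ⟨N, ?_⟩
    rintro _ ⟨m, rfl⟩
    exact hN m trivial
  · intro v
    obtain ⟨n, m, h⟩ := exists_pow_smul_eq_tmul (ε.symm v)
    refine ⟨n, m, ?_⟩
    rw [hι, ← h]
    have h2 := (ε.toLinearMap.restrictScalars (W p k)).map_smul ((p : W p k) ^ n) (ε.symm v)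
    exact h2.trans (congrArg _ (ε.apply_symm_apply v))

/-! ### Frobenius images of lattices and the conclusion -/

instance : RingHomSurjective (σ p k) := ⟨(WittVector.frobenius_bijective p k).surjective⟩

theorem IsLattice.map_frob {L : Submodule (W p k) (Fin d → E p k)} (hL : IsLattice L)
    (hF : ∀ x ∈ L, frob p k d x ∈ L) : IsLattice (L.map (frob p k d)) where
  bounded := by
    obtain ⟨n, hn⟩ := hL.bounded
    refine ⟨n, ?_⟩
    rintro _ ⟨v, hv, rfl⟩
    exact hn _ (hF v hv)
  full v := by
    obtain ⟨w, rfl⟩ := frob_surjective v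
    obtain ⟨n, hn⟩ := hL.full w
    exact ⟨n, _, hn, by rw [map_smulₛₗ, map_pow, map_natCast]⟩

/-- `L` is `Fⁿ S`, built by one `σ`-linear image at a time and described by its elements, since `Fⁿ`
is only `σⁿ`-linear. -/
theorem IsLattice.exists_iterate_frob {S : Submodule (W p k) (Fin d → E p k)} (hS : IsLattice S)
    (hF : ∀ x ∈ S, frob p k d x ∈ S) (hT : ∀ x ∈ S, twist p k d x ∈ S) (n : ℕ) :
    ∃ L : Submodule (W p k) (Fin d → E p k), IsLattice L ∧ (∀ x ∈ L, frob p k d x ∈ L) ∧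
      (∀ x ∈ L, twist p k d x ∈ L) ∧ ∀ x, x ∈ L ↔ ∃ y ∈ S, (frob p k d)^[n] y = x := by
  induction n with
  | zero => exact ⟨S, hS, hF, hT, fun x => by simp⟩
  | succ n ih =>
    obtain ⟨L, hL, hLF, hLT, hmem⟩ := ih
    refine ⟨L.map (frob p k d), hL.map_frob hLF, ?_, ?_, fun x => ?_⟩
    · rintro _ ⟨x, hx, rfl⟩
      exact ⟨_, hLF x hx, rfl⟩
    · rintro _ ⟨x, hx, rfl⟩
      exact ⟨_, hLT x hx, frob_twist x⟩
    · rw [Submodule.mem_map]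
      simp only [hmem, Function.iterate_succ_apply']
      constructor
      · rintro ⟨_, ⟨y, hy, rfl⟩, rfl⟩
        exact ⟨y, hy, rfl⟩
      · rintro ⟨y, hy, rfl⟩
        exact ⟨_, ⟨y, hy, rfl⟩, rfl⟩

theorem IsLattice.twistHull {M : Submodule (W p k) (Fin d → E p k)} (hM : IsLattice M) (n : ℕ) :
    IsLattice (twistHull M (n + 1)) where
  bounded := by
    obtain ⟨N, hN⟩ := hM.bounded
    -- `T` fixes `p` and preserves the standard lattice, so the exponent for `M` serves every `Tⁱ
    -- M`.
    refine ⟨N, ?_⟩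
    generalize n + 1 = m
    induction m with
    | zero =>
      intro v hv
      rw [(Submodule.mem_bot _).mp hv, smul_zero]
      exact Submodule.zero_mem _
    | succ m ih =>
      intro v hv
      obtain ⟨x, hx, _, ⟨y, hy, rfl⟩, rfl⟩ := Submodule.mem_sup.mp hv
      rw [smul_add]
      refine Submodule.add_mem _ (hN x hx) fun i j => ?_
      obtain ⟨w, hw⟩ := ih y hy i j
      refine ⟨τ p k w, ?_⟩
      rw [← τB_algebraMap, hw, ← twist_apply, map_smulₛₗ, map_pow, map_natCast]
  full v := by
    obtain ⟨N, hN⟩ := hM.full v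
    exact ⟨N, Submodule.mem_sup_left hN⟩

theorem IsSupersingular.existsMono {φ : M →ₛₗ[σ p k] M} (hφ : IsSupersingular φ)
    (hrank : Module.finrank (W p k) M = 2 * (d + 1)) : ExistsMono φ (d + 1) d := by
  obtain ⟨ι, hinj, hcomm, hlat⟩ := hφ.exists_embedding hrank
  have hiter : ∀ n m, ι (φ^[n] m) = (frob p k (d + 1))^[n] (ι m) := fun n m => by
    induction n with
    | zero => rfl
    | succ n ih => rw [Function.iterate_succ_apply', Function.iterate_succ_apply', hcomm, ih]
  have hF : ∀ x ∈ LinearMap.range ι, frob p k (d + 1) x ∈ LinearMap.range ι := by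
    rintro _ ⟨m, rfl⟩
    exact ⟨φ m, hcomm m⟩
  have hV : ∀ x ∈ LinearMap.range ι, ∃ y ∈ LinearMap.range ι,
      frob p k (d + 1) y = (p : W p k) • x := by
    rintro _ ⟨m, rfl⟩
    obtain ⟨y, hy⟩ := hφ.p_smul_mem m
    exact ⟨ι y, ⟨y, rfl⟩, by rw [← hcomm, hy, map_smul]⟩
  -- The rank is `2(d + 1)`, so the hull has the `d + 1` terms `M, …, T^d M` and `F^d` brings it
  -- back into `M`.
  obtain ⟨L, hL, hLF, hLT, hmem⟩ := (hlat.twistHull d).exists_iterate_frob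
    (frob_mem_twistHull hF _) (twist_mem_twistHull_self hF) d
  obtain ⟨z, hzT, hzinj, hzL⟩ := hL.exists_ofFixed hLF hLT
  have hzM : ∀ w, ofFixed z w ∈ LinearMap.range ι := by
    intro w
    obtain ⟨y, hy, h⟩ := (hmem (ofFixed z w)).mp (hzL ▸ ⟨w, rfl⟩)
    rw [← h]
    exact iterate_frob_mem_of_mem_twistHull hF hV d y hy
  let j : (Fin (d + 1) → N p k) →ₗ[W p k] M :=
    (LinearEquiv.ofInjective ι hinj).symm.toLinearMap.comp ((ofFixed z).codRestrict _ hzM)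
  have hj : ∀ w, ι (j w) = ofFixed z w := fun w =>
    congrArg Subtype.val ((LinearEquiv.ofInjective ι hinj).apply_symm_apply ⟨ofFixed z w, hzM w⟩)
  refine ⟨j, fun v w h => hzinj ?_, fun v => hinj ?_, fun m => ?_⟩
  · rw [← hj, ← hj, h]
  · rw [hcomm, hj, hj, ofFixed_frobNPow hzT]
  · have h : (frob p k (d + 1))^[d] (ι m) ∈ LinearMap.range (ofFixed z) := by
      rw [hzL, hmem]
      exact ⟨ι m, Submodule.mem_sup_left ⟨m, rfl⟩, rfl⟩
    obtain ⟨w, hw⟩ := h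
    exact ⟨w, hinj (by rw [hj, hw, hiter])⟩

end Dieudonne

end

theorem lemma2p4 (p : ℕ) [Fact p.Prime] (k : Type*) [Field k] [IsAlgClosed k] [CharP k p]
    (d : ℕ) (hd : 1 ≤ d) (M : Type*) [AddCommGroup M] [Module (Dieudonne.W p k) M]
    (φ : M →ₛₗ[Dieudonne.σ p k] M) (hφ : Dieudonne.IsSupersingular φ)
    (hrank : Module.finrank (Dieudonne.W p k) M = 2 * d) :
    (∃ j : (Fin d → Dieudonne.N p k) →ₗ[Dieudonne.W p k] M,
      Function.Injective j ∧
      (∀ v, j (Dieudonne.frobNPow p k d v) = φ (j v)) ∧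
      ∀ m : M, φ^[d - 1] m ∈ LinearMap.range j) ∧
    Dieudonne.invariantQ φ d ≤ d - 1 := by
  obtain ⟨d, rfl⟩ := Nat.exists_eq_add_of_le' hd
  have h := hφ.existsMono hrank
  exact ⟨h, Nat.sInf_le h⟩
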